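/- Let $N\ge 1$ and let $\mathbf a=(a_1,\dots,a_n)$ and $\mathbf b=(b_1,\dots,b_m)$ be compositions of $N$ (finite sequences of positive integers with sum $N$). They cut $\{1,\dots,N\}$ into consecutive blocks $A_1,\dots,A_n$ of sizes $a_i$, respectively $B_1,\dots,B_m$ of sizes $b_j$. The seaweed algebra $\mathfrak p\frac{\mathbf a}{\mathbf b}\subseteq\mathfrak{gl}(N,\mathbb C)$ is the Lie subalgebra spanned by the matrix units $E_{p,p}$ ($1\le p\le N$), $E_{p,q}$ with $p>q$ in a common block $A_i$, and $E_{p,q}$ with $p<q$ in a common block $B_j$; the type-A seaweed algebra $\mathfrak p^A\frac{\mathbf a}{\mathbf b}\subseteq\mathfrak{sl}(N,\mathbb C)$ is its subalgebra of trace-zero matrices. For $\mathfrak s$ equal to $\mathfrak p\frac{\mathbf a}{\mathbf b}$ or $\mathfrak p^A\frac{\mathbf a}{\mathbf b}$, the meander $\mathrm M(\mathfrak s)$ is the graph on vertices $v_1,\dots,v_N$, possibly with parallel edges, in which each block $A_i=\{s,s+1,\dots,t\}$ contributes the (top) edges joining $v_{s+k}$ and $v_{t-k}$ for all $k\ge 0$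 with $s+k<t-k$, and each block $B_j$ contributes (bottom) edges in the same way. Let $\mathrm E_1(\mathfrak s)$ be the set of edges of $\mathrm M(\mathfrak s)$ such that no other edge joins the same two vertices. Let $\lambda_1<\dots<\lambda_\ell=N$ be the numbers that are partial sums $c_1+\dots+c_j$ ($j\ge1$) of both $\mathbf a$ and $\mathbf b$, and put $\lambda_0=0$; the set $\mathrm{Cen}(\mathfrak s)$ of central components consists of the $\ell$ subgraphs of $\mathrm M(\mathfrak s)$ on the vertex sets $\{v_i : \lambda_{j-1}<i\le\lambda_j\}$, $1\le j\le\ell$. Let $\mathfrak n(\mathfrak s)$ be the nilradical of $\mathfrak s$ (its largest nilpotent ideal), and for a finite-dimensional complex Lie algebra $\mathfrak g$ let $\operatorname{ind}\mathfrak g=\min_{F\in\mathfrak g^*}\dim\ker F([-,-])$. **Proposition.** Suppose that all $a_i\in\{1,2\}$, and that either all $b_j\in\{1,2\}$ or $\mathbf b=(N)$. Then $$\operatorname{ind}\mathfrak n(\mathfrak s)=|\mathrm E_1(\mathfrak s)|+|\mathrm{Cen}(\mathfrak s)|\quad\text{for }\mathfrak s=\mathfrak p\tfrac{\mathbf a}{\mathbf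 b},$$ $$\operatorname{ind}\mathfrak n(\mathfrak s)=|\mathrm E_1(\mathfrak s)|+|\mathrm{Cen}(\mathfrak s)|-1\quad\text{for }\mathfrak s=\mathfrak p^A\tfrac{\mathbf a}{\mathbf b}.$$ -/

import Mathlib

attribute [local instance 100] LieRing.ofAssociativeRing

/-- The alternating form `(x, y) ↦ F ⁅x, y⁆` attached to a linear functional `F` on `L`. -/
def LieAlgebra.bracketForm {K L : Type*} [Field K] [LieRing L] [LieAlgebra K L]
    (F : Module.Dual K L) : L →ₗ[K] L →ₗ[K] K :=
  LinearMap.mk₂ K (fun x y => F ⁅x, y⁆)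
    (fun x x' y => by rw [add_lie, map_add])
    (fun c x y => by rw [smul_lie, map_smul])
    (fun x y y' => by rw [lie_add, map_add])
    (fun c x y => by rw [lie_smul, map_smul])

/-- The index of a finite-dimensional Lie algebra: the least dimension of the kernel of
`F ⁅-, -⁆`, where `F` runs over the dual space. -/
noncomputable def LieAlgebra.index (K L : Type*) [Field K] [LieRing L] [LieAlgebra K L] : ℕ :=
  sInf (Set.range fun F : Module.Dual K L =>
    Module.finrank K (LinearMap.ker (LieAlgebra.bracketForm F)))

/-- The nilradical of a finite-dimensional Lie algebra: the largest ideal that is nilpotent as a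
Lie algebra. (This is not `LieAlgebra.maxNilpotentIdeal`, which asks for nilpotency as an
`L`-module.) -/
def LieAlgebra.nilradical (K L : Type*) [Field K] [LieRing L] [LieAlgebra K L] : LieIdeal K L :=
  sSup {I : LieIdeal K L | LieRing.IsNilpotent I}

namespace Seaweed

variable {N : ℕ}

/-- `Supp a b p q` says that the matrix unit `E_{p,q}` is one of the generators of the seaweed
algebra `𝔭 (a / b)`: it is diagonal, or it lies below the diagonal with `p`, `q` in one block of
the top composition `a`, or above the diagonal with `p`, `q` in one block of the bottom
composition `b`. -/
def Supp (a b : Composition N) (p q : Fin N) : Prop :=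
  p = q ∨ (q < p ∧ a.index p = a.index q) ∨ (p < q ∧ b.index p = b.index q)

theorem index_mono (c : Composition N) {p q : Fin N} (h : p ≤ q) : c.index p ≤ c.index q := by
  by_contra! hlt
  have h1 : c.sizeUpTo ((c.index q : ℕ) + 1) ≤ c.sizeUpTo (c.index p) :=
    c.monotone_sizeUpTo (by exact_mod_cast hlt)
  have h2 := c.sizeUpTo_index_le p
  have h3 := c.lt_sizeUpTo_index_succ q
  have h4 : (p : ℕ) ≤ q := h
  simp only [Fin.val_succ] at h3
  omega

theorem index_eq_of_between (c : Composition N) {p q r : Fin N} (hpq : p ≤ q) (hqr : q ≤ r)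
    (h : c.index p = c.index r) : c.index p = c.index q ∧ c.index q = c.index r := by
  have h1 := index_mono c hpq
  have h2 := index_mono c hqr
  exact ⟨le_antisymm h1 (h ▸ h2), le_antisymm h2 (h ▸ h1)⟩

theorem Supp.trans {a b : Composition N} {p q r : Fin N} (h₁ : Supp a b p q)
    (h₂ : Supp a b q r) : Supp a b p r := by
  rcases h₁ with rfl | ⟨h, e⟩ | ⟨h, e⟩
  · exact h₂
  · rcases h₂ with rfl | ⟨h', e'⟩ | ⟨h', e'⟩
    · exact Or.inr (Or.inl ⟨h, e⟩)
    · exact Or.inr (Or.inl ⟨h'.trans h, e.trans e'⟩)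
    · rcases lt_trichotomy p r with hpr | rfl | hpr
      · exact Or.inr (Or.inr ⟨hpr, (index_eq_of_between b h.le hpr.le e').2⟩)
      · exact Or.inl rfl
      · exact Or.inr (Or.inl ⟨hpr, (index_eq_of_between a h'.le hpr.le e.symm).2.symm⟩)
  · rcases h₂ with rfl | ⟨h', e'⟩ | ⟨h', e'⟩
    · exact Or.inr (Or.inr ⟨h, e⟩)
    · rcases lt_trichotomy p r with hpr | rfl | hpr
      · exact Or.inr (Or.inr ⟨hpr, (index_eq_of_between b hpr.le h'.le e).1⟩)
      · exact Or.inl rfl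
      · exact Or.inr (Or.inl ⟨hpr, (index_eq_of_between a hpr.le h.le e'.symm).1.symm⟩)
    · exact Or.inr (Or.inr ⟨h.trans h', e.trans e'⟩)

theorem mul_apply_eq_zero {a b : Composition N} {x y : Matrix (Fin N) (Fin N) ℂ}
    (hx : ∀ p q, ¬ Supp a b p q → x p q = 0) (hy : ∀ p q, ¬ Supp a b p q → y p q = 0)
    (p r : Fin N) (h : ¬ Supp a b p r) : (x * y) p r = 0 := by
  rw [Matrix.mul_apply]
  refine Finset.sum_eq_zero fun q _ => ?_
  by_cases h₁ : Supp a b p q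
  · rw [hy q r fun h₂ => h (h₁.trans h₂), mul_zero]
  · rw [hx p q h₁, zero_mul]

/-- The seaweed algebra `𝔭 (a / b)` inside `𝔤𝔩(N, ℂ)`: the matrices supported on the positions
allowed by `Supp a b`, that is, the span of the corresponding matrix units. -/
def seaweed (a b : Composition N) : LieSubalgebra ℂ (Matrix (Fin N) (Fin N) ℂ) where
  carrier := {x | ∀ p q, ¬ Supp a b p q → x p q = 0}
  add_mem' := fun hx hy p q h => by rw [Matrix.add_apply, hx p q h, hy p q h, add_zero]
  zero_mem' := fun _ _ _ => rfl
  smul_mem' := fun c x hx p q h => by rw [Matrix.smul_apply, hx p q h, smul_zero]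
  lie_mem' := fun {x y} hx hy p q h => by
    rw [Ring.lie_def, Matrix.sub_apply, mul_apply_eq_zero hx hy p q h,
      mul_apply_eq_zero hy hx p q h, sub_zero]

theorem seaweed_toSubmodule (a b : Composition N) :
    (seaweed a b).toSubmodule =
      Submodule.span ℂ {x | ∃ p q, Supp a b p q ∧ x = Matrix.single p q (1 : ℂ)} := by
  apply le_antisymm
  · intro x hx
    rw [Matrix.matrix_eq_sum_single x]
    refine Submodule.sum_mem _ fun p _ => Submodule.sum_mem _ fun q _ => ?_
    by_cases h : Supp a b p q
    · have := Submodule.smul_mem _ (x p q) (Submodule.subset_span (R := ℂ)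
        (s := {x | ∃ p q, Supp a b p q ∧ x = Matrix.single p q (1 : ℂ)}) ⟨p, q, h, rfl⟩)
      simpa [Matrix.smul_single] using this
    · have h0 : x p q = 0 := hx p q h
      simp [h0]
  · rw [Submodule.span_le]
    rintro _ ⟨p, q, h, rfl⟩ p' q' h'
    refine Matrix.single_apply_of_ne _ _ _ _ _ ?_
    rintro ⟨rfl, rfl⟩
    exact h' h

/-- The type-A seaweed algebra `𝔭ᴬ (a / b)`: the trace-zero matrices in `𝔭 (a / b)`. -/
def seaweedA (a b : Composition N) : LieSubalgebra ℂ (Matrix (Fin N) (Fin N) ℂ) :=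
  seaweed a b ⊓ LieAlgebra.SpecialLinear.sl (Fin N) ℂ

/-- The arcs that the blocks of one composition contribute to a meander: in each block the first
vertex is joined to the last, the second to the second-to-last, and so on, as long as the two are
distinct. An arc is recorded by its endpoints `(p, q)` with `p < q`; numbering vertices from `0`,
the block with index `i` is `{sizeUpTo i, …, sizeUpTo (i + 1) - 1}`. -/
def arcs (c : Composition N) : Finset (Fin N × Fin N) :=
  Finset.univ.filter fun e => e.1 < e.2 ∧ c.index e.1 = c.index e.2 ∧
    (e.1 : ℕ) + e.2 + 1 = c.sizeUpTo (c.index e.1) + c.sizeUpTo ((c.index e.1 : ℕ) + 1)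

/-- The edges of the meander `M(a / b)`, a graph with possible parallel edges: top edges (from the
top composition `a`) are tagged by `Sum.inl`, bottom edges (from `b`) by `Sum.inr`. -/
def edges (a b : Composition N) : Finset (Fin N × Fin N ⊕ Fin N × Fin N) :=
  (arcs a).disjSum (arcs b)

/-- The two vertices joined by an edge, the left one first. -/
def ends : Fin N × Fin N ⊕ Fin N × Fin N → Fin N × Fin N :=
  Sum.elim id id

/-- `E₁`: the edges of the meander for which no other edge joins the same two vertices. -/
def E₁ (a b : Composition N) : Finset (Fin N × Fin N ⊕ Fin N × Fin N) :=
  (edges a b).filter fun e => ∀ e' ∈ edges a b, ends e' = ends e → e' = e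

/-- The set of partial sums `c₁ + ⋯ + c_j`, `1 ≤ j ≤ n`, of a composition `(c₁, …, c_n)`. -/
def PS (c : Composition N) : Finset ℕ :=
  (Finset.range c.length).image fun j => c.sizeUpTo (j + 1)

/-- The central components of the meander, each given by its set of vertices: cut the vertices
after each common partial sum of `a` and `b`. The component ending at the common partial sum `l`
has the vertices number `k` with `k ≤ l` and `m < k` for all common partial sums `m < l`, where
`i : Fin N` is the vertex number `i + 1`. -/
def Cen (a b : Composition N) : Finset (Finset (Fin N)) :=
  (PS a ∩ PS b).image fun l =>
    Finset.univ.filter fun i : Fin N => (i : ℕ) + 1 ≤ l ∧ ∀ m ∈ PS a ∩ PS b, m < l → m < (i : ℕ) + 1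

end Seaweed

/-! Call a position strict if it is allowed and its transpose is not. The allowed positions form a
preorder, and the nilradical of either algebra consists of its matrices with strict off-diagonal
entries and a diagonal constant on each central component (`nilradical_eq`). Its dimension is the
number of strict positions plus |Cen|, less one when the trace must vanish.

The index is squeezed between two bounds (`index_nilIdeal`). Let Q be a set of strict positions such
that the elements vanishing on Q commute. They form an isotropic subspace for every functional, so
every kernel has dimension at least dim - 2|Q|. One functional whose kernel vanishes at 2|Q| strict
positions attains this. It remains to see that the number of strict positions is 2|Q| + |E₁|.

If all blocks have size at most two, strict positions never compose: Q is empty, and the strict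
positions are the unpaired arcs. If b = (N), the strict positions are those above the diagonal,
except the superdiagonal ones inside blocks of a. Here Q collects the strict positions lying on one
side of a middle cut, and the sum along the antidiagonal pairs each of them with a position
straddling the cut. -/

namespace Seaweed

open Matrix

variable {N : ℕ} {a b : Composition N}

/-! ### The candidate for the nilradical, and its nilpotency -/

/-- The positions `(p, q)` allowed by `Supp a b` whose transpose is not allowed. -/
def StrictSupp (a b : Composition N) (p q : Fin N) : Prop :=
  Supp a b p q ∧ ¬ Supp a b q p

theorem Supp.refl (p : Fin N) : Supp a b p p := Or.inl rfl

theorem StrictSupp.ne {p q : Fin N} (h : StrictSupp a b p q) : p ≠ q := by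
  rintro rfl
  exact h.2 h.1

theorem Supp.trans_strict {p q r : Fin N} (h₁ : Supp a b p q) (h₂ : StrictSupp a b q r) :
    StrictSupp a b p r :=
  ⟨h₁.trans h₂.1, fun h => h₂.2 (h.trans h₁)⟩

theorem StrictSupp.trans_supp {p q r : Fin N} (h₁ : StrictSupp a b p q) (h₂ : Supp a b q r) :
    StrictSupp a b p r :=
  ⟨h₁.1.trans h₂, fun h => h₁.2 (h₂.trans h)⟩

/-- The matrices supported on the strictly allowed positions and the diagonal, with equal diagonal
entries at `p` and `q` whenever `(p, q)` is allowed. -/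
def nilSubmodule (a b : Composition N) : Submodule ℂ (Matrix (Fin N) (Fin N) ℂ) where
  carrier := {x | (∀ p q, p ≠ q → ¬ StrictSupp a b p q → x p q = 0) ∧
    ∀ p q, Supp a b p q → x p p = x q q}
  add_mem' := fun hx hy => ⟨fun p q h h' => by simp [hx.1 p q h h', hy.1 p q h h'],
    fun p q h => by simp [hx.2 p q h, hy.2 p q h]⟩
  zero_mem' := ⟨fun _ _ _ _ => rfl, fun _ _ _ => rfl⟩
  smul_mem' := fun c x hx => ⟨fun p q h h' => by simp [hx.1 p q h h'],
    fun p q h => by simp [hx.2 p q h]⟩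

theorem nilSubmodule_le_seaweed {x : Matrix (Fin N) (Fin N) ℂ} (hx : x ∈ nilSubmodule a b) :
    x ∈ seaweed a b := by
  intro p q h
  refine hx.1 p q ?_ fun h' => h h'.1
  rintro rfl
  exact h (Supp.refl p)

theorem single_mem_seaweed {p q : Fin N} (h : Supp a b p q) (c : ℂ) :
    single p q c ∈ seaweed a b := by
  intro p' q' h'
  refine single_apply_of_ne _ _ _ _ _ ?_
  rintro ⟨rfl, rfl⟩
  exact h' h

theorem single_mem_nilSubmodule {p q : Fin N} (h : StrictSupp a b p q) (c : ℂ) :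
    single p q c ∈ nilSubmodule a b := by
  refine ⟨fun p' q' _ h' => single_apply_of_ne _ _ _ _ _ ?_, fun p' q' _ => ?_⟩
  · rintro ⟨rfl, rfl⟩
    exact h' h
  · rw [single_apply_of_ne, single_apply_of_ne]
    · rintro ⟨rfl, h'⟩
      exact h.ne h'.symm
    · rintro ⟨rfl, h'⟩
      exact h.ne h'.symm

theorem one_mem_nilSubmodule : (1 : Matrix (Fin N) (Fin N) ℂ) ∈ nilSubmodule a b :=
  ⟨fun p q h _ => by simp [h], fun p q _ => by simp⟩

/-- The off-diagonal part of a matrix. -/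
def offDiag (x : Matrix (Fin N) (Fin N) ℂ) : Matrix (Fin N) (Fin N) ℂ :=
  x - diagonal x.diag

theorem offDiag_apply (x : Matrix (Fin N) (Fin N) ℂ) (p q : Fin N) :
    offDiag x p q = if p = q then 0 else x p q := by
  by_cases h : p = q
  · subst h
    simp [offDiag]
  · simp [offDiag, h]

theorem offDiag_apply_eq_zero {x : Matrix (Fin N) (Fin N) ℂ} (hx : x ∈ nilSubmodule a b)
    {p q : Fin N} (h : ¬ StrictSupp a b p q) : offDiag x p q = 0 := by
  rw [offDiag_apply]
  split_ifs with hpq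
  · rfl
  · exact hx.1 p q hpq h

/-- The two products scale the entry of `y` at (p, q) by the diagonal entries of `x` at p and at q,
which agree wherever `y` may be nonzero. Hence brackets only see `offDiag x`. -/
theorem diagonal_diag_mul_comm {x y : Matrix (Fin N) (Fin N) ℂ} (hx : x ∈ nilSubmodule a b)
    (hy : y ∈ seaweed a b) : diagonal x.diag * y = y * diagonal x.diag := by
  ext p q
  rw [diagonal_mul, mul_diagonal, mul_comm]
  by_cases h : Supp a b p q
  · simp [hx.2 p q h]
  · simp [hy p q h]

theorem lie_eq_offDiag_lie {x y : Matrix (Fin N) (Fin N) ℂ} (hx : x ∈ nilSubmodule a b)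
    (hy : y ∈ seaweed a b) : x * y - y * x = offDiag x * y - y * offDiag x := by
  have := diagonal_diag_mul_comm hx hy
  simp only [offDiag, sub_mul, mul_sub, this]
  abel

theorem lie_mem_nilSubmodule {x y : Matrix (Fin N) (Fin N) ℂ} (hx : x ∈ nilSubmodule a b)
    (hy : y ∈ seaweed a b) : x * y - y * x ∈ nilSubmodule a b := by
  rw [lie_eq_offDiag_lie hx hy]
  have key : ∀ p q, ¬ StrictSupp a b p q → (offDiag x * y - y * offDiag x) p q = 0 := by
    intro p q h
    rw [Matrix.sub_apply, mul_apply, mul_apply, Finset.sum_eq_zero, Finset.sum_eq_zero, sub_zero]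
    · intro r _
      by_cases h₁ : Supp a b p r
      · rw [offDiag_apply_eq_zero hx fun h₂ => h (h₁.trans_strict h₂), mul_zero]
      · rw [hy p r h₁, zero_mul]
    · intro r _
      by_cases h₁ : Supp a b r q
      · rw [offDiag_apply_eq_zero hx fun h₂ => h (h₂.trans_supp h₁), zero_mul]
      · rw [hy r q h₁, mul_zero]
  exact ⟨fun p q _ h => key p q h, fun p q _ => by
    rw [key p p fun h => h.ne rfl, key q q fun h => h.ne rfl]⟩

open Classical in
theorem card_strictSupp_lt {p q : Fin N} (h : StrictSupp a b p q) :
    (Finset.univ.filter fun r => StrictSupp a b q r).card <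
      (Finset.univ.filter fun r => StrictSupp a b p r).card := by
  refine Finset.card_lt_card ⟨fun r hr => ?_, fun hsub => ?_⟩
  · simp only [Finset.mem_filter, Finset.mem_univ, true_and] at hr ⊢
    exact h.1.trans_strict hr
  · have := hsub (Finset.mem_filter.2 ⟨Finset.mem_univ q, h⟩)
    exact (Finset.mem_filter.1 this).2.ne rfl

/-- A nonzero entry of the n-th power needs a chain of n strict steps. Each step loses at least one
strict successor, and a vertex has at most N of them. -/
theorem isNilpotent_offDiag {x : Matrix (Fin N) (Fin N) ℂ} (hx : x ∈ nilSubmodule a b) :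
    IsNilpotent (offDiag x) := by
  classical
  have key : ∀ (n : ℕ) (p q : Fin N),
      (Finset.univ.filter fun r => StrictSupp a b p r).card <
        (Finset.univ.filter fun r => StrictSupp a b q r).card + n →
      (offDiag x ^ n) p q = 0 := by
    intro n
    induction n with
    | zero =>
      intro p q h
      rw [pow_zero, one_apply_ne]
      rintro rfl
      exact lt_irrefl _ h
    | succ n ih =>
      intro p q h
      rw [pow_succ', mul_apply]
      refine Finset.sum_eq_zero fun r _ => ?_
      by_cases hs : StrictSupp a b p r
      · have := card_strictSupp_lt hs
        rw [ih r q (by omega), mul_zero]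
      · rw [offDiag_apply_eq_zero hx hs, zero_mul]
  refine ⟨N + 1, ?_⟩
  ext p q
  refine key _ _ _ ?_
  have := Finset.card_le_univ (Finset.univ.filter fun r => StrictSupp a b p r)
  rw [Fintype.card_fin] at this
  omega

/-- The elements of a Lie subalgebra `T` of the seaweed algebra that lie in `nilSubmodule`. -/
def nilIdeal {T : LieSubalgebra ℂ (Matrix (Fin N) (Fin N) ℂ)} (hT : T ≤ seaweed a b) :
    LieIdeal ℂ T where
  toSubmodule := (nilSubmodule a b).comap T.toSubmodule.subtype
  lie_mem := by
    intro y x hx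
    have h := (nilSubmodule a b).neg_mem (lie_mem_nilSubmodule (show (x : Matrix _ _ ℂ) ∈ _ from hx)
      (hT y.2))
    rw [neg_sub] at h
    exact h

theorem mem_nilIdeal {T : LieSubalgebra ℂ (Matrix (Fin N) (Fin N) ℂ)} (hT : T ≤ seaweed a b)
    {x : T} : x ∈ nilIdeal hT ↔ (x : Matrix (Fin N) (Fin N) ℂ) ∈ nilSubmodule a b :=
  Iff.rfl

/-- By Engel, since `x` acts on the ideal as the nilpotent matrix `offDiag x` does. -/
theorem isNilpotent_nilIdeal {T : LieSubalgebra ℂ (Matrix (Fin N) (Fin N) ℂ)}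
    (hT : T ≤ seaweed a b) : LieRing.IsNilpotent (nilIdeal hT) := by
  rw [LieAlgebra.isNilpotent_iff_forall (R := ℂ)]
  intro x
  obtain ⟨n, hn⟩ := LieAlgebra.ad_nilpotent_of_nilpotent (R := ℂ)
    (isNilpotent_offDiag ((mem_nilIdeal hT).1 x.2))
  refine ⟨n, ?_⟩
  have key : ∀ (k : ℕ) (y : nilIdeal hT),
      ((((LieAlgebra.ad ℂ (nilIdeal hT) x ^ k) y : nilIdeal hT) : T) : Matrix (Fin N) (Fin N) ℂ) =
        (LieAlgebra.ad ℂ (Matrix (Fin N) (Fin N) ℂ) (offDiag ((x : T) : Matrix _ _ ℂ)) ^ k)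
          ((y : T) : Matrix (Fin N) (Fin N) ℂ) := by
    intro k
    induction k with
    | zero => intro y; rfl
    | succ k ih =>
      intro y
      rw [pow_succ, pow_succ, Module.End.mul_apply, Module.End.mul_apply, ih]
      congr 1
      exact lie_eq_offDiag_lie ((mem_nilIdeal hT).1 x.2) (hT (y : T).2)
  ext1 y
  apply Subtype.ext
  apply Subtype.ext
  rw [key n y, hn]
  rfl

/-! ### Every nilpotent ideal lies in the candidate -/

variable {T : LieSubalgebra ℂ (Matrix (Fin N) (Fin N) ℂ)}

/-- Scalars are central, so an ideal of `T` is stable under brackets with the whole seaweed algebra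
once `T` reaches it modulo scalars. This treats both algebras at once. -/
theorem lie_mem_of_lieIdeal (hT : ∀ y ∈ seaweed a b, ∃ c : ℂ, y - c • 1 ∈ T) (I : LieIdeal ℂ T)
    {y : Matrix (Fin N) (Fin N) ℂ} (hy : y ∈ seaweed a b) {z : T} (hz : z ∈ I) :
    ∃ w ∈ I, (w : Matrix (Fin N) (Fin N) ℂ) = y * z - z * y := by
  obtain ⟨c, hc⟩ := hT y hy
  refine ⟨⁅(⟨_, hc⟩ : T), z⁆, lie_mem_right ℂ T I _ _ hz, ?_⟩
  change (y - c • 1) * (z : Matrix _ _ ℂ) - (z : Matrix _ _ ℂ) * (y - c • 1) = _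
  rw [sub_mul, mul_sub, smul_mul_assoc, mul_smul_comm, one_mul, mul_one]
  abel

theorem single_apply_mem_of_lieIdeal (hT : ∀ y ∈ seaweed a b, ∃ c : ℂ, y - c • 1 ∈ T)
    (I : LieIdeal ℂ T) {z : T} (hz : z ∈ I) {p q : Fin N} (hpq : p ≠ q) :
    ∃ w ∈ I, (w : Matrix (Fin N) (Fin N) ℂ) = single p q ((z : Matrix _ _ ℂ) p q) := by
  obtain ⟨w₁, hw₁, e₁⟩ := lie_mem_of_lieIdeal hT I (single_mem_seaweed (Supp.refl p) 1) hz
  obtain ⟨w₂, hw₂, e₂⟩ := lie_mem_of_lieIdeal hT I (single_mem_seaweed (Supp.refl q) 1) hw₁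
  obtain ⟨w₃, hw₃, e₃⟩ := lie_mem_of_lieIdeal hT I (single_mem_seaweed (Supp.refl p) 1) hw₂
  -- `w₂` keeps only the entries at (p, q) and (q, p), both with factor -1; in `w₃` the factors are
  -- -1 and +1. The sum leaves -2 at (p, q) alone.
  refine ⟨(-2⁻¹ : ℂ) • (w₂ + w₃), I.smul_mem _ (I.add_mem hw₂ hw₃), ?_⟩
  change (-2⁻¹ : ℂ) • ((w₂ : Matrix (Fin N) (Fin N) ℂ) + (w₃ : Matrix (Fin N) (Fin N) ℂ)) = _
  have mulL : ∀ (r : Fin N) (y : Matrix (Fin N) (Fin N) ℂ) (i j : Fin N),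
      (single r r (1 : ℂ) * y) i j = if i = r then y i j else 0 := by
    intro r y i j
    rw [← diagonal_single, diagonal_mul, Pi.single_apply]
    split_ifs <;> simp
  have mulR : ∀ (r : Fin N) (y : Matrix (Fin N) (Fin N) ℂ) (i j : Fin N),
      (y * single r r (1 : ℂ)) i j = if j = r then y i j else 0 := by
    intro r y i j
    rw [← diagonal_single, mul_diagonal, Pi.single_apply]
    split_ifs <;> simp
  rw [e₃, e₂, e₁]
  ext i j
  simp only [Matrix.smul_apply, Matrix.add_apply, Matrix.sub_apply, mulL, mulR, smul_eq_mul,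
    single_apply]
  by_cases h1 : i = p <;> by_cases h2 : i = q <;> by_cases h3 : j = p <;> by_cases h4 : j = q <;>
    grind

/-- One bracket moves `L` into `I`, where the action is already nilpotent; Engel does the rest. -/
theorem lieModule_isNilpotent_of_lieIdeal {L : Type*} [LieRing L] [LieAlgebra ℂ L]
    [FiniteDimensional ℂ L] (I : LieIdeal ℂ L) (hI : LieRing.IsNilpotent I) :
    LieModule.IsNilpotent I L := by
  rw [LieAlgebra.isNilpotent_iff_forall (R := ℂ)] at hI
  rw [LieModule.isNilpotent_iff_forall (R := ℂ)]
  intro x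
  obtain ⟨n, hn⟩ := hI x
  refine ⟨n + 1, ?_⟩
  have key : ∀ (k : ℕ) (y : I), ((LieModule.toEnd ℂ I L x) ^ k) (y : L) =
      ((LieAlgebra.ad ℂ I x ^ k) y : I) := by
    intro k
    induction k with
    | zero => intro y; rfl
    | succ k ih =>
      intro y
      rw [pow_succ, pow_succ, Module.End.mul_apply, Module.End.mul_apply, ← ih]
      rfl
  ext1 y
  rw [pow_succ, Module.End.mul_apply]
  have := key n ⟨⁅(x : L), y⁆, lie_mem_left ℂ L I _ _ x.2⟩
  rw [hn] at this
  exact this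

/-- Otherwise bracketing with `x` multiplies the (p, q) entry of the matrix unit by a nonzero
number, so this unit survives in every term of the lower central series of `I` acting on `T`. -/
theorem diag_eq_of_mem_nilpotent_lieIdeal (hT : ∀ y ∈ seaweed a b, ∃ c : ℂ, y - c • 1 ∈ T)
    (I : LieIdeal ℂ T) (hI : LieRing.IsNilpotent I) {x : T} (hx : x ∈ I) {p q : Fin N}
    (hpq : Supp a b p q) : (x : Matrix _ _ ℂ) p p = (x : Matrix _ _ ℂ) q q := by
  by_cases hne : p = q
  · rw [hne]
  by_contra hd
  have hd' := sub_ne_zero.2 hd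
  obtain ⟨k, hk⟩ := (LieModule.isNilpotent_iff ℂ I T).1 (lieModule_isNilpotent_of_lieIdeal I hI)
  have hk' : I.lcs T k = ⊥ := by
    rw [← LieSubmodule.toSubmodule_inj, LieIdeal.coe_lcs_eq, hk]
    rfl
  have key : ∀ n, ∃ w ∈ I.lcs T n, (w : Matrix (Fin N) (Fin N) ℂ) = single p q 1 := by
    intro n
    induction n with
    | zero =>
      obtain ⟨c, hc⟩ := hT _ (single_mem_seaweed hpq 1)
      obtain ⟨w, -, hw⟩ := single_apply_mem_of_lieIdeal hT ⊤ (LieSubmodule.mem_top ⟨_, hc⟩) hne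
      refine ⟨w, LieSubmodule.mem_top _, ?_⟩
      rw [hw]
      simp [hne]
    | succ n ih =>
      obtain ⟨w, hw, e⟩ := ih
      have h1 : ⁅x, w⁆ ∈ I.lcs T (n + 1) := by
        rw [LieIdeal.lcs_succ]
        exact LieSubmodule.lie_mem_lie hx hw
      obtain ⟨v, hv, ev⟩ := single_apply_mem_of_lieIdeal hT _ h1 hne
      have e1 : ((⁅x, w⁆ : T) : Matrix (Fin N) (Fin N) ℂ) p q =
          (x : Matrix _ _ ℂ) p p - (x : Matrix _ _ ℂ) q q := by
        change ((x : Matrix (Fin N) (Fin N) ℂ) * (w : Matrix (Fin N) (Fin N) ℂ) -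
          (w : Matrix (Fin N) (Fin N) ℂ) * x) p q = _
        rw [e]
        simp
      refine ⟨((x : Matrix _ _ ℂ) p p - (x : Matrix _ _ ℂ) q q)⁻¹ • v,
        (I.lcs T (n + 1)).smul_mem _ hv, ?_⟩
      change ((x : Matrix _ _ ℂ) p p - (x : Matrix _ _ ℂ) q q)⁻¹ •
        (v : Matrix (Fin N) (Fin N) ℂ) = _
      rw [ev, e1, smul_single, smul_eq_mul, inv_mul_cancel₀ hd']
  obtain ⟨w, hw, e⟩ := key k
  rw [hk', LieSubmodule.mem_bot] at hw
  have := congrFun (congrFun e p) q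
  rw [hw] at this
  simp at this

theorem le_nilIdeal (hT : T ≤ seaweed a b) (hT' : ∀ y ∈ seaweed a b, ∃ c : ℂ, y - c • 1 ∈ T)
    (I : LieIdeal ℂ T) (hI : LieRing.IsNilpotent I) : I ≤ nilIdeal hT := by
  intro x hx
  rw [mem_nilIdeal]
  refine ⟨fun p q hne hpq => ?_, fun p q => diag_eq_of_mem_nilpotent_lieIdeal hT' I hI hx⟩
  by_cases h : Supp a b p q
  · have h' : Supp a b q p := by
      by_contra h'
      exact hpq ⟨h, h'⟩
    -- With c the entry of `x` at (p, q), bracketing `single q p 1` with `single p q c` gives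
    -- diagonal entries -c at p and c at q. They must agree, so c = 0.
    obtain ⟨w, hw, e⟩ := single_apply_mem_of_lieIdeal hT' I hx hne
    obtain ⟨v, hv, ev⟩ := lie_mem_of_lieIdeal hT' I (single_mem_seaweed h' 1) hw
    have := diag_eq_of_mem_nilpotent_lieIdeal hT' I hI hv h
    rw [ev, e] at this
    simp [hne, hne.symm] at this
    exact neg_eq_self.1 this
  · exact hT x.2 p q h

theorem nilradical_eq (hT : T ≤ seaweed a b) (hT' : ∀ y ∈ seaweed a b, ∃ c : ℂ, y - c • 1 ∈ T) :
    LieAlgebra.nilradical ℂ T = nilIdeal hT :=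
  le_antisymm (sSup_le fun I hI => le_nilIdeal hT hT' I hI) (le_sSup (isNilpotent_nilIdeal hT))

end Seaweed

/-! ### Dimension counts and isotropic subspaces -/

theorem Submodule.finrank_comap_of_injective {K V U : Type*} [Field K] [AddCommGroup V] [Module K V]
    [AddCommGroup U] [Module K U] {f : V →ₗ[K] U} (hf : Function.Injective f)
    (X : Submodule K U) :
    Module.finrank K (X.comap f) = Module.finrank K ↥(LinearMap.range f ⊓ X) := by
  rw [← Submodule.map_comap_eq]
  exact (Submodule.equivMapOfInjective f hf _).finrank_eq

theorem Submodule.finrank_inf_ker_add {K V U : Type*} [Field K] [AddCommGroup V] [Module K V]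
    [FiniteDimensional K V] [AddCommGroup U] [Module K U] (W : Submodule K V) (g : V →ₗ[K] U)
    (hg : W.map g = ⊤) :
    Module.finrank K ↥(W ⊓ LinearMap.ker g) + Module.finrank K U = Module.finrank K W := by
  have h := LinearMap.finrank_range_add_finrank_ker (g.domRestrict W)
  rw [LinearMap.range_domRestrict, hg, finrank_top, LinearMap.ker_domRestrict] at h
  rw [← h, add_comm, Submodule.finrank_comap_of_injective W.injective_subtype,
    Submodule.range_subtype]

/-- `B` sends `P` into the annihilator of `P`, of dimension dim V - dim P, with kernel inside `ker
B`. -/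
theorem LinearMap.two_mul_finrank_le_of_isotropic {K V : Type*} [Field K] [AddCommGroup V]
    [Module K V] [FiniteDimensional K V] (B : V →ₗ[K] V →ₗ[K] K) (P : Submodule K V)
    (hP : ∀ x ∈ P, ∀ y ∈ P, B x y = 0) :
    2 * Module.finrank K P ≤ Module.finrank K V + Module.finrank K (LinearMap.ker B) := by
  have h := LinearMap.finrank_range_add_finrank_ker (B.domRestrict P)
  have h1 : Module.finrank K (LinearMap.range (B.domRestrict P)) ≤
      Module.finrank K P.dualAnnihilator := by
    refine Submodule.finrank_mono ?_
    rintro _ ⟨x, rfl⟩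
    rw [Submodule.mem_dualAnnihilator]
    exact fun y hy => hP x x.2 y hy
  have h2 := Subspace.finrank_add_finrank_dualAnnihilator_eq P
  have h3 : Module.finrank K (LinearMap.ker (B.domRestrict P)) ≤
      Module.finrank K (LinearMap.ker B) := by
    rw [LinearMap.ker_domRestrict, Submodule.finrank_comap_of_injective P.injective_subtype]
    exact Submodule.finrank_mono inf_le_right
  omega

/-! ### The index squeezed between two bounds -/

namespace Seaweed

open Matrix

variable {N : ℕ} {a b : Composition N} {T : LieSubalgebra ℂ (Matrix (Fin N) (Fin N) ℂ)}

/-- The entries of a matrix at a finite set of positions. -/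
def entries (R : Finset (Fin N × Fin N)) : Matrix (Fin N) (Fin N) ℂ →ₗ[ℂ] R → ℂ where
  toFun x e := x e.1.1 e.1.2
  map_add' _ _ := rfl
  map_smul' _ _ := rfl

theorem mem_ker_entries {R : Finset (Fin N × Fin N)} {x : Matrix (Fin N) (Fin N) ℂ} :
    x ∈ LinearMap.ker (entries R) ↔ ∀ p q, (p, q) ∈ R → x p q = 0 := by
  rw [LinearMap.mem_ker]
  exact ⟨fun h p q hpq => congrFun h ⟨(p, q), hpq⟩, fun h => funext fun e => h _ _ e.2⟩

theorem map_entries_eq_top {R : Finset (Fin N × Fin N)}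
    {W : Submodule ℂ (Matrix (Fin N) (Fin N) ℂ)}
    (hW : ∀ p q, (p, q) ∈ R → single p q (1 : ℂ) ∈ W) : W.map (entries R) = ⊤ := by
  rw [eq_top_iff]
  intro u _
  refine ⟨∑ e : R, u e • single e.1.1 e.1.2 (1 : ℂ),
    W.sum_mem fun e _ => W.smul_mem _ (hW _ _ e.2), ?_⟩
  ext e
  change (∑ e : R, u e • single e.1.1 e.1.2 (1 : ℂ)) e.1.1 e.1.2 = u e
  rw [Matrix.sum_apply, Finset.sum_eq_single e]
  · simp
  · intro e' _ hne
    rw [Matrix.smul_apply, single_apply_of_ne, smul_zero]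
    exact fun h => hne (Subtype.ext (Prod.ext h.1 h.2))
  · simp

theorem finrank_inf_ker_entries {R : Finset (Fin N × Fin N)}
    {W : Submodule ℂ (Matrix (Fin N) (Fin N) ℂ)}
    (hW : ∀ p q, (p, q) ∈ R → single p q (1 : ℂ) ∈ W) :
    Module.finrank ℂ ↥(W ⊓ LinearMap.ker (entries R)) + R.card = Module.finrank ℂ W := by
  rw [← W.finrank_inf_ker_add _ (map_entries_eq_top hW), Module.finrank_fintype_fun_eq_card,
    Fintype.card_coe]

/-- Of two composable strict positions at least one is in `Q`, so every term in a product of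
off-diagonal parts has a zero factor. -/
theorem commutator_eq_zero_of_entries_eq_zero {Q : Finset (Fin N × Fin N)}
    (hQ : ∀ p q r, StrictSupp a b p q → StrictSupp a b q r → (p, q) ∉ Q → (q, r) ∈ Q)
    {x y : Matrix (Fin N) (Fin N) ℂ} (hx : x ∈ nilSubmodule a b) (hy : y ∈ nilSubmodule a b)
    (hxQ : x ∈ LinearMap.ker (entries Q)) (hyQ : y ∈ LinearMap.ker (entries Q)) :
    x * y - y * x = 0 := by
  have key : ∀ {x y : Matrix (Fin N) (Fin N) ℂ}, x ∈ nilSubmodule a b → y ∈ nilSubmodule a b →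
      x ∈ LinearMap.ker (entries Q) → y ∈ LinearMap.ker (entries Q) →
      offDiag x * offDiag y = 0 := by
    intro x y hx hy hxQ hyQ
    ext p r
    rw [mul_apply, Matrix.zero_apply]
    refine Finset.sum_eq_zero fun q _ => ?_
    by_cases h₁ : StrictSupp a b p q
    · by_cases h₂ : StrictSupp a b q r
      · by_cases h₃ : (p, q) ∈ Q
        · rw [offDiag_apply, if_neg h₁.ne, mem_ker_entries.1 hxQ p q h₃, zero_mul]
        · rw [offDiag_apply y, if_neg h₂.ne, mem_ker_entries.1 hyQ q r (hQ p q r h₁ h₂ h₃),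
            mul_zero]
      · rw [offDiag_apply_eq_zero hy h₂, mul_zero]
    · rw [offDiag_apply_eq_zero hx h₁, zero_mul]
  have hd : offDiag x ∈ seaweed a b := fun p q h => offDiag_apply_eq_zero hx fun h' => h h'.1
  rw [lie_eq_offDiag_lie hx (nilSubmodule_le_seaweed hy), ← neg_sub,
    lie_eq_offDiag_lie hy hd, key hx hy hxQ hyQ, key hy hx hyQ hxQ, sub_zero, neg_zero]

/-- `Q` gives the lower bound for every functional, through the isotropic subspace of codimension
|Q|; `f` and `R` give the matching upper bound, as the kernel of its form has codimension at least
|R| = 2|Q|. -/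
theorem index_nilIdeal (hT : T ≤ seaweed a b)
    (hS : ∀ p q, StrictSupp a b p q → single p q (1 : ℂ) ∈ T)
    {Q R : Finset (Fin N × Fin N)} (hQS : ∀ p q, (p, q) ∈ Q → StrictSupp a b p q)
    (hRS : ∀ p q, (p, q) ∈ R → StrictSupp a b p q) (hRQ : R.card = 2 * Q.card)
    (hQ : ∀ p q r, StrictSupp a b p q → StrictSupp a b q r → (p, q) ∉ Q → (q, r) ∈ Q)
    (f : Module.Dual ℂ (Matrix (Fin N) (Fin N) ℂ))
    (hf : ∀ x ∈ nilSubmodule a b,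
      (∀ p q, StrictSupp a b p q → f (x * single p q 1 - single p q 1 * x) = 0) →
      ∀ p q, (p, q) ∈ R → x p q = 0) :
    LieAlgebra.index ℂ (nilIdeal hT) + R.card =
      Module.finrank ℂ ↥(nilSubmodule a b ⊓ T.toSubmodule) := by
  set W := nilSubmodule a b ⊓ T.toSubmodule with hWdef
  let ι : nilIdeal hT →ₗ[ℂ] Matrix (Fin N) (Fin N) ℂ :=
    T.toSubmodule.subtype ∘ₗ (nilIdeal hT).toSubmodule.subtype
  have hι : Function.Injective ι := Subtype.val_injective.comp Subtype.val_injective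
  have hmem : ∀ x, ι x ∈ W := fun x => ⟨x.2, x.1.2⟩
  have hrange : LinearMap.range ι = W :=
    le_antisymm (by rintro _ ⟨x, rfl⟩; exact hmem x) fun x hx => ⟨⟨⟨x, hx.2⟩, hx.1⟩, rfl⟩
  have hlie : ∀ x y, ι ⁅x, y⁆ = ι x * ι y - ι y * ι x := fun _ _ => rfl
  have hcomap : ∀ X : Submodule ℂ (Matrix (Fin N) (Fin N) ℂ),
      Module.finrank ℂ (X.comap ι) = Module.finrank ℂ ↥(W ⊓ X) := by
    intro X
    rw [Submodule.finrank_comap_of_injective hι, hrange]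
  have hdim : Module.finrank ℂ (nilIdeal hT) = Module.finrank ℂ W := by
    rw [← hrange, LinearMap.finrank_range_of_inj hι]
  have hsingle : ∀ p q, StrictSupp a b p q → single p q (1 : ℂ) ∈ W :=
    fun p q h => ⟨single_mem_nilSubmodule h 1, hS p q h⟩
  have hdimQ := finrank_inf_ker_entries (W := W) fun p q h => hsingle p q (hQS p q h)
  have hdimR := finrank_inf_ker_entries (W := W) fun p q h => hsingle p q (hRS p q h)
  have lower : ∀ F : Module.Dual ℂ (nilIdeal hT), Module.finrank ℂ W ≤
      Module.finrank ℂ (LinearMap.ker (LieAlgebra.bracketForm F)) + R.card := by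
    intro F
    have h := LinearMap.two_mul_finrank_le_of_isotropic (LieAlgebra.bracketForm F)
      ((LinearMap.ker (entries Q)).comap ι) fun x hx y hy => by
        have h0 : ⁅x, y⁆ = 0 := hι (by
          rw [hlie, map_zero]
          exact commutator_eq_zero_of_entries_eq_zero hQ (hmem x).1 (hmem y).1 hx hy)
        change F ⁅x, y⁆ = 0
        rw [h0, map_zero]
    rw [hcomap, hdim] at h
    omega
  have upper : Module.finrank ℂ (LinearMap.ker (LieAlgebra.bracketForm (f ∘ₗ ι))) + R.card ≤
      Module.finrank ℂ W := by
    rw [← hdimR, ← hcomap]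
    refine Nat.add_le_add_right (Submodule.finrank_mono fun x hx => ?_) _
    rw [Submodule.mem_comap, mem_ker_entries]
    refine hf (ι x) (hmem x).1 fun p q hpq => ?_
    obtain ⟨y, hy⟩ : single p q (1 : ℂ) ∈ LinearMap.range ι := hrange ▸ hsingle p q hpq
    rw [← hy, ← hlie]
    exact LinearMap.congr_fun hx y
  have h1 : LieAlgebra.index ℂ (nilIdeal hT) ≤
      Module.finrank ℂ (LinearMap.ker (LieAlgebra.bracketForm (f ∘ₗ ι))) :=
    Nat.sInf_le ⟨_, rfl⟩
  obtain ⟨F, hF⟩ : LieAlgebra.index ℂ (nilIdeal hT) ∈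
      Set.range fun F : Module.Dual ℂ (nilIdeal hT) =>
        Module.finrank ℂ (LinearMap.ker (LieAlgebra.bracketForm F)) :=
    Nat.sInf_mem ⟨_, 0, rfl⟩
  have h2 := lower F
  simp only at hF
  omega

/-! ### Central components and the dimension of the nilradical -/

/-- With vertices numbered from 0, a partial sum m cuts between m - 1 and m. -/
theorem index_eq_iff_forall_PS (c : Composition N) {p q : Fin N} (h : p ≤ q) :
    c.index p = c.index q ↔ ∀ m ∈ PS c, (p : ℕ) < m → (q : ℕ) < m := by
  have hq := c.sizeUpTo_index_le q
  have hp := c.lt_sizeUpTo_index_succ p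
  have hq' := c.lt_sizeUpTo_index_succ q
  have hp' := c.sizeUpTo_index_le p
  simp only [Fin.val_succ] at hp hq'
  constructor
  · intro e m hm hpm
    obtain ⟨j, hj, rfl⟩ := Finset.mem_image.1 hm
    by_contra! hlt
    have h1 : (c.index p : ℕ) < j + 1 := by
      by_contra! h'
      have := c.monotone_sizeUpTo h'
      omega
    have h2 : j < (c.index q : ℕ) := by
      by_contra! h'
      have := c.monotone_sizeUpTo (Nat.succ_le_succ h')
      simp only [Nat.succ_eq_add_one] at this
      omega
    rw [e] at h1
    omega
  · intro H
    by_contra hne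
    have hlt : (c.index p : ℕ) < c.index q := lt_of_le_of_ne (index_mono c h) fun e => hne (Fin.ext e)
    have := H _ (Finset.mem_image.2 ⟨_, Finset.mem_range.2 (c.index p).2, rfl⟩) hp
    have := c.monotone_sizeUpTo (Nat.succ_le_of_lt hlt)
    simp only [Nat.succ_eq_add_one] at this
    omega

theorem mem_PS_self (hN : 0 < N) (c : Composition N) : N ∈ PS c := by
  have h : 0 < c.length := c.length_pos_iff.2 hN
  refine Finset.mem_image.2 ⟨c.length - 1, Finset.mem_range.2 (by omega), ?_⟩
  rw [Nat.sub_add_cancel h, c.sizeUpTo_length]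

theorem pos_and_le_of_mem_PS {c : Composition N} {m : ℕ} (h : m ∈ PS c) : 0 < m ∧ m ≤ N := by
  obtain ⟨j, hj, rfl⟩ := Finset.mem_image.1 h
  exact ⟨(Nat.zero_le _).trans_lt (c.sizeUpTo_strict_mono (Finset.mem_range.1 hj)),
    c.sizeUpTo_le _⟩

/-- The last vertex before a common partial sum. -/
def lastVertex (l : ↥(PS a ∩ PS b)) : Fin N :=
  ⟨l - 1, by
    have := pos_and_le_of_mem_PS (Finset.mem_inter.1 l.2).1
    omega⟩

theorem lastVertex_val (l : ↥(PS a ∩ PS b)) : (lastVertex l : ℕ) + 1 = l := by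
  have := pos_and_le_of_mem_PS (Finset.mem_inter.1 l.2).1
  simp only [lastVertex]
  omega

/-- A component determines its last vertex, hence its common partial sum. -/
theorem card_Cen (a b : Composition N) : (Cen a b).card = (PS a ∩ PS b).card := by
  refine Finset.card_image_of_injOn ?_
  have key : ∀ l ∈ PS a ∩ PS b, ∀ l' ∈ PS a ∩ PS b,
      (Finset.univ.filter fun i : Fin N => (i : ℕ) + 1 ≤ l ∧
        ∀ m ∈ PS a ∩ PS b, m < l → m < (i : ℕ) + 1) =
      (Finset.univ.filter fun i : Fin N => (i : ℕ) + 1 ≤ l' ∧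
        ∀ m ∈ PS a ∩ PS b, m < l' → m < (i : ℕ) + 1) → l' ≤ l := by
    intro l hl l' hl' e
    by_contra! hlt
    have hv := lastVertex_val ⟨l, hl⟩
    simp only at hv
    have h1 := (Finset.ext_iff.1 e (lastVertex ⟨l, hl⟩)).1 (by
      simp only [Finset.mem_filter, Finset.mem_univ, true_and, hv]
      exact ⟨le_rfl, fun _ _ h => h⟩)
    have h2 := (Finset.mem_filter.1 h1).2.2 l hl hlt
    omega
  exact fun l hl l' hl' e => le_antisymm (key l' hl' l hl e.symm) (key l hl l' hl' e)

theorem exists_common_PS (hN : 0 < N) (a b : Composition N) (i : Fin N) :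
    ((PS a ∩ PS b).filter fun l => (i : ℕ) < l).Nonempty :=
  ⟨N, Finset.mem_filter.2 ⟨Finset.mem_inter.2 ⟨mem_PS_self hN a, mem_PS_self hN b⟩, i.2⟩⟩

/-- The first common partial sum after a vertex. -/
def nextCut (hN : 0 < N) (a b : Composition N) (i : Fin N) : ↥(PS a ∩ PS b) :=
  ⟨((PS a ∩ PS b).filter fun l => (i : ℕ) < l).min' (exists_common_PS hN a b i),
    Finset.filter_subset _ _ (Finset.min'_mem _ _)⟩

theorem lt_nextCut (hN : 0 < N) (i : Fin N) : (i : ℕ) < nextCut hN a b i :=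
  (Finset.mem_filter.1 (Finset.min'_mem _ (exists_common_PS hN a b i))).2

theorem nextCut_le (hN : 0 < N) {i : Fin N} {l : ℕ} (hl : l ∈ PS a ∩ PS b) (h : (i : ℕ) < l) :
    (nextCut hN a b i : ℕ) ≤ l :=
  Finset.min'_le _ _ (Finset.mem_filter.2 ⟨hl, h⟩)

theorem nextCut_lastVertex (hN : 0 < N) (l : ↥(PS a ∩ PS b)) :
    nextCut hN a b (lastVertex l) = l := by
  have h := lastVertex_val l
  have h1 := lt_nextCut (a := a) (b := b) hN (lastVertex l)
  have h2 := nextCut_le hN l.2 (i := lastVertex l) (by omega)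
  exact Subtype.ext (by omega)

theorem nextCut_eq_of_supp (hN : 0 < N) {p q : Fin N} (h : Supp a b p q) :
    nextCut hN a b p = nextCut hN a b q := by
  have key : ∀ {p q : Fin N} (c : Composition N), p < q → c.index p = c.index q →
      (∀ l ∈ PS a ∩ PS b, l ∈ PS c) → nextCut hN a b p = nextCut hN a b q := by
    intro p q c hpq e hc
    have hlt : (p : ℕ) < q := hpq
    refine Subtype.ext (le_antisymm
      (nextCut_le hN (nextCut hN a b q).2 (hlt.trans (lt_nextCut hN q)))
      (nextCut_le hN (nextCut hN a b p).2 ?_))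
    exact (index_eq_iff_forall_PS c hpq.le).1 e _ (hc _ (nextCut hN a b p).2) (lt_nextCut hN p)
  rcases h with rfl | ⟨h, e⟩ | ⟨h, e⟩
  · rfl
  · exact (key a h e.symm fun l hl => (Finset.mem_inter.1 hl).1).symm
  · exact key b h e fun l hl => (Finset.mem_inter.1 hl).2

/-- Neighbours not separated by a common partial sum share a block of `a` or of `b`, hence a
diagonal entry; walk to the end of the component. -/
theorem diag_eq_lastVertex_nextCut (hN : 0 < N) {x : Matrix (Fin N) (Fin N) ℂ}
    (hx : x ∈ nilSubmodule a b) (i : Fin N) :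
    x i i = x (lastVertex (nextCut hN a b i)) (lastVertex (nextCut hN a b i)) := by
  have key : ∀ (k : ℕ) (h : (i : ℕ) + k < N), (i : ℕ) + k < nextCut hN a b i →
      x i i = x ⟨i + k, h⟩ ⟨i + k, h⟩ := by
    intro k
    induction k with
    | zero => intro h _; rfl
    | succ k ih =>
      intro h hk
      rw [ih (by omega) (by omega)]
      have hnot : (i : ℕ) + k + 1 ∉ PS a ∩ PS b := by
        intro hmem
        have := nextCut_le hN hmem (i := i) (by omega)
        omega
      have hle : (⟨i + k, by omega⟩ : Fin N) < ⟨i + (k + 1), h⟩ := by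
        rw [Fin.mk_lt_mk]; omega
      have hidx : ∀ c : Composition N, (i : ℕ) + k + 1 ∉ PS c →
          c.index ⟨i + k, by omega⟩ = c.index ⟨i + (k + 1), h⟩ := by
        intro c hc
        rw [index_eq_iff_forall_PS c hle.le]
        intro m hm hlt
        have : m ≠ (i : ℕ) + k + 1 := fun e => hc (e ▸ hm)
        simp only at hlt ⊢
        omega
      by_cases hA : (i : ℕ) + k + 1 ∈ PS a
      · exact hx.2 _ _ (Or.inr (Or.inr ⟨hle, hidx b fun hB => hnot (Finset.mem_inter.2 ⟨hA, hB⟩)⟩))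
      · exact (hx.2 _ _ (Or.inr (Or.inl ⟨hle, (hidx a hA).symm⟩))).symm
  have h1 := lt_nextCut (a := a) (b := b) hN i
  have h2 := lastVertex_val (nextCut hN a b i)
  have h3 := (lastVertex (nextCut hN a b i)).2
  have := key (lastVertex (nextCut hN a b i) - i) (by omega) (by omega)
  rw [this]
  congr 1 <;> exact Fin.ext (by simp only; omega)

/-- The diagonal entries at the last vertices of the central components. -/
def cutEntries (a b : Composition N) :
    Matrix (Fin N) (Fin N) ℂ →ₗ[ℂ] ↥(PS a ∩ PS b) → ℂ where
  toFun x l := x (lastVertex l) (lastVertex l)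
  map_add' _ _ := rfl
  map_smul' _ _ := rfl

/-- Once the strict entries are removed, a diagonal matrix remains, with one free value per central
component. -/
theorem finrank_nilSubmodule (hN : 0 < N) {S : Finset (Fin N × Fin N)}
    (hS : ∀ p q, (p, q) ∈ S ↔ StrictSupp a b p q) :
    Module.finrank ℂ (nilSubmodule a b) = S.card + (Cen a b).card := by
  rw [← finrank_inf_ker_entries (R := S) fun p q h => single_mem_nilSubmodule ((hS p q).1 h) 1,
    add_comm, card_Cen]
  congr 1
  set W := nilSubmodule a b ⊓ LinearMap.ker (entries S) with hW
  have htop : W.map (cutEntries a b) = ⊤ := by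
    rw [eq_top_iff]
    intro u _
    refine ⟨diagonal fun i => u (nextCut hN a b i), ⟨⟨fun p q h _ => diagonal_apply_ne _ h,
      fun p q h => ?_⟩, mem_ker_entries.2 fun p q h => ?_⟩, ?_⟩
    · rw [diagonal_apply_eq, diagonal_apply_eq, nextCut_eq_of_supp hN h]
    · exact diagonal_apply_ne _ ((hS p q).1 h).ne
    · ext l
      change diagonal _ (lastVertex l) (lastVertex l) = u l
      rw [diagonal_apply_eq, nextCut_lastVertex]
  have hbot : W ⊓ LinearMap.ker (cutEntries a b) = ⊥ := by
    rw [eq_bot_iff]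
    rintro x ⟨⟨hx, hxS⟩, hxC⟩
    rw [Submodule.mem_bot]
    ext p q
    by_cases hpq : p = q
    · subst hpq
      rw [diag_eq_lastVertex_nextCut hN hx]
      exact congrFun (LinearMap.mem_ker.1 hxC) _
    · by_cases h : StrictSupp a b p q
      · exact mem_ker_entries.1 hxS p q ((hS p q).2 h)
      · exact hx.1 p q hpq h
  rw [← W.finrank_inf_ker_add _ htop, hbot, finrank_bot, zero_add,
    Module.finrank_fintype_fun_eq_card, Fintype.card_coe]

theorem mem_sl_iff (x : Matrix (Fin N) (Fin N) ℂ) :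
    x ∈ LieAlgebra.SpecialLinear.sl (Fin N) ℂ ↔ x.trace = 0 :=
  Iff.rfl

theorem finrank_nilSubmodule_inf_sl (hN : 0 < N) :
    Module.finrank ℂ ↥(nilSubmodule a b ⊓ (seaweedA a b).toSubmodule) + 1 =
      Module.finrank ℂ (nilSubmodule a b) := by
  have htop : (nilSubmodule a b).map (traceLinearMap (Fin N) ℂ ℂ) = ⊤ := by
    rw [eq_top_iff]
    intro u _
    have hN' : (N : ℂ) ≠ 0 := by exact_mod_cast hN.ne'
    refine ⟨(u / N) • 1, Submodule.smul_mem _ _ one_mem_nilSubmodule, ?_⟩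
    simp [hN']
  rw [← (nilSubmodule a b).finrank_inf_ker_add _ htop, Module.finrank_self]
  have : nilSubmodule a b ⊓ (seaweedA a b).toSubmodule =
      nilSubmodule a b ⊓ LinearMap.ker (traceLinearMap (Fin N) ℂ ℂ) := by
    ext x
    constructor
    · rintro ⟨h1, h2⟩
      exact ⟨h1, (mem_sl_iff x).1 h2.2⟩
    · rintro ⟨h1, h2⟩
      exact ⟨h1, nilSubmodule_le_seaweed h1, (mem_sl_iff x).2 h2⟩
  rw [this]

/-- The indices of both nilradicals, from a set `Q` of positions whose complement spans an abelian
subalgebra and a functional whose form is as nondegenerate as `Q` permits. -/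
theorem index_nilradical (hN : 0 < N) {e : ℕ} {S Q R : Finset (Fin N × Fin N)}
    (hS : ∀ p q, (p, q) ∈ S ↔ StrictSupp a b p q) (hQS : Q ⊆ S) (hRS : R ⊆ S)
    (hRQ : R.card = 2 * Q.card)
    (hQ : ∀ p q r, StrictSupp a b p q → StrictSupp a b q r → (p, q) ∉ Q → (q, r) ∈ Q)
    (f : Module.Dual ℂ (Matrix (Fin N) (Fin N) ℂ))
    (hf : ∀ x ∈ nilSubmodule a b,
      (∀ p q, StrictSupp a b p q → f (x * single p q 1 - single p q 1 * x) = 0) →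
      ∀ p q, (p, q) ∈ R → x p q = 0)
    (he : S.card = 2 * Q.card + e) :
    LieAlgebra.index ℂ (LieAlgebra.nilradical ℂ (seaweed a b)) = e + (Cen a b).card ∧
      (LieAlgebra.index ℂ (LieAlgebra.nilradical ℂ (seaweedA a b)) : ℤ) =
        e + (Cen a b).card - 1 := by
  have hdim := finrank_nilSubmodule hN hS
  constructor
  · rw [nilradical_eq (le_refl (seaweed a b)) fun y hy => ⟨0, by simpa using hy⟩]
    have h := index_nilIdeal (le_refl (seaweed a b)) (fun p q h => single_mem_seaweed h.1 1)
      (fun p q h => (hS p q).1 (hQS h)) (fun p q h => (hS p q).1 (hRS h)) hRQ hQ f hf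
    rw [inf_eq_left.2 fun x hx => nilSubmodule_le_seaweed hx] at h
    omega
  · have hT : seaweedA a b ≤ seaweed a b := inf_le_left
    -- Subtracting the scalar `y.trace / N` makes the trace vanish.
    rw [nilradical_eq hT fun y hy => ⟨y.trace / N, ?_⟩]
    · have h := index_nilIdeal hT
        (fun p q h => ⟨single_mem_seaweed h.1 1, (mem_sl_iff _).2
          (trace_single_eq_of_ne p q 1 h.ne)⟩)
        (fun p q h => (hS p q).1 (hQS h)) (fun p q h => (hS p q).1 (hRS h)) hRQ hQ f hf
      have h' := finrank_nilSubmodule_inf_sl (a := a) (b := b) hN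
      omega
    · have hN' : (N : ℂ) ≠ 0 := by exact_mod_cast hN.ne'
      refine ⟨(seaweed a b).sub_mem hy ((seaweed a b).smul_mem _
        (nilSubmodule_le_seaweed one_mem_nilSubmodule)), (mem_sl_iff _).2 ?_⟩
      simp [hN']

/-! ### Arcs of small blocks, and the case where all blocks have size at most two -/

theorem sizeUpTo_of_blocks_le_two {c : Composition N} (hc : ∀ x ∈ c.blocks, x ∈ Finset.Icc 1 2)
    {p q : Fin N} (h : p < q) (e : c.index p = c.index q) :
    (q : ℕ) = p + 1 ∧ c.sizeUpTo (c.index p) = p ∧ c.sizeUpTo ((c.index p : ℕ) + 1) = p + 2 := by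
  have h1 := (Finset.mem_Icc.1 (hc _ (c.blocksFun_mem_blocks (c.index p)))).2
  have h2 := c.sizeUpTo_succ' (c.index p)
  have h3 := c.sizeUpTo_index_le p
  have h4 := c.lt_sizeUpTo_index_succ q
  have h5 : (p : ℕ) < q := h
  rw [← e, Fin.val_succ] at h4
  omega

theorem mem_arcs_of_blocks_le_two {c : Composition N} (hc : ∀ x ∈ c.blocks, x ∈ Finset.Icc 1 2)
    {p q : Fin N} : (p, q) ∈ arcs c ↔ p < q ∧ c.index p = c.index q := by
  simp only [arcs, Finset.mem_filter, Finset.mem_univ, true_and]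
  refine ⟨fun h => ⟨h.1, h.2.1⟩, fun h => ⟨h.1, h.2, ?_⟩⟩
  have := sizeUpTo_of_blocks_le_two hc h.1 h.2
  omega

theorem index_single (hN : 0 < N) (p q : Fin N) :
    (Composition.single N hN).index p = (Composition.single N hN).index q := by
  have h : (Composition.single N hN).length = 1 := Composition.single_length hN
  exact Fin.ext (by omega)

theorem mem_arcs_single (hN : 0 < N) {p q : Fin N} :
    (p, q) ∈ arcs (Composition.single N hN) ↔ p < q ∧ (p : ℕ) + q + 1 = N := by
  have h : (Composition.single N hN).length = 1 := Composition.single_length hN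
  have h0 : ((Composition.single N hN).index p : ℕ) = 0 := by omega
  simp only [arcs, Finset.mem_filter, Finset.mem_univ, true_and, index_single hN p q]
  rw [← index_single hN p q, h0, Composition.sizeUpTo_zero,
    Composition.sizeUpTo_ofLength_le _ _ h.le, zero_add]

/-- Arcs of one composition have distinct end pairs, so only a top and a bottom edge can be
parallel. -/
theorem card_E₁ (a b : Composition N) :
    (E₁ a b).card = (arcs a \ arcs b).card + (arcs b \ arcs a).card := by
  rw [← Finset.card_disjSum]
  congr 1
  ext e
  rw [E₁, Finset.mem_filter]
  obtain e | e := e <;>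
  · simp only [edges, ends, Finset.inl_mem_disjSum, Finset.inr_mem_disjSum, Finset.mem_sdiff,
      Sum.forall, Sum.elim_inl, Sum.elim_inr, id_eq]
    grind

theorem index_nilradical_of_blocks_le_two (hN : 0 < N)
    (ha : ∀ x ∈ a.blocks, x ∈ Finset.Icc 1 2) (hb : ∀ x ∈ b.blocks, x ∈ Finset.Icc 1 2) :
    LieAlgebra.index ℂ (LieAlgebra.nilradical ℂ (seaweed a b)) =
        (E₁ a b).card + (Cen a b).card ∧
      (LieAlgebra.index ℂ (LieAlgebra.nilradical ℂ (seaweedA a b)) : ℤ) =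
        (E₁ a b).card + (Cen a b).card - 1 := by
  have hS : ∀ p q, (p, q) ∈ (arcs a \ arcs b).map (Equiv.prodComm _ _).toEmbedding ∪
      (arcs b \ arcs a) ↔ StrictSupp a b p q := by
    intro p q
    simp only [Finset.mem_union, Finset.mem_map_equiv, Equiv.prodComm_symm, Equiv.prodComm_apply,
      Prod.swap_prod_mk, Finset.mem_sdiff, mem_arcs_of_blocks_le_two ha,
      mem_arcs_of_blocks_le_two hb, StrictSupp, Supp]
    grind
  refine index_nilradical hN hS (Finset.empty_subset _) (Finset.empty_subset _) rfl ?_ 0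
    (fun _ _ _ _ _ h => absurd h (Finset.notMem_empty _)) ?_
  -- Two steps in the same direction would put three vertices in one block. Two steps in opposite
  -- directions return to p = r, making the transpose of (p, q) allowed.
  · rintro p q r h₁ h₂ -
    exfalso
    have ha' := fun {p q : Fin N} (h : p < q) (e : a.index p = a.index q) =>
      (sizeUpTo_of_blocks_le_two ha h e).1
    have hb' := fun {p q : Fin N} (h : p < q) (e : b.index p = b.index q) =>
      (sizeUpTo_of_blocks_le_two hb h e).1
    have key : ∀ (c : Composition N) (x y z : Fin N), x < y → y < z → c.index x = c.index y →
        c.index y = c.index z → (∀ x ∈ c.blocks, x ∈ Finset.Icc 1 2) → False := by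
      intro c x y z hxy hyz e₁ e₂ hc
      have h1 := (sizeUpTo_of_blocks_le_two hc hxy e₁).1
      have h2 := (sizeUpTo_of_blocks_le_two hc (hxy.trans hyz) (e₁.trans e₂)).1
      have h3 : (y : ℕ) < z := hyz
      omega
    have hpq := h₁.ne
    have hqr := h₂.ne
    obtain ⟨h₁, h₁'⟩ := h₁
    obtain ⟨h₂, h₂'⟩ := h₂
    rcases h₁ with h | ⟨h, e⟩ | ⟨h, e⟩
    · exact hpq h
    · rcases h₂ with h' | ⟨h', e'⟩ | ⟨h', e'⟩
      · exact hqr h'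
      · exact key a r q p h' h e'.symm e.symm ha
      · have h1 := ha' h e.symm
        have h2 := hb' h' e'
        obtain rfl : p = r := Fin.ext (h1.trans h2.symm)
        exact h₁' (Or.inr (Or.inr ⟨h', e'⟩))
    · rcases h₂ with h' | ⟨h', e'⟩ | ⟨h', e'⟩
      · exact hqr h'
      · have h1 := hb' h e
        have h2 := ha' h' e'.symm
        obtain rfl : p = r := Fin.ext (by omega)
        exact h₁' (Or.inr (Or.inl ⟨h', e'⟩))
      · exact key b p q r h h' e e' hb
  · rw [Finset.card_empty, mul_zero, zero_add, card_E₁, Finset.card_union_of_disjoint,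
      Finset.card_map]
    rw [Finset.disjoint_left]
    rintro ⟨p, q⟩ h h'
    simp only [Finset.mem_map_equiv, Equiv.prodComm_symm, Equiv.prodComm_apply,
      Prod.swap_prod_mk, Finset.mem_sdiff, mem_arcs_of_blocks_le_two ha,
      mem_arcs_of_blocks_le_two hb] at h h'
    exact lt_asymm h.1.1 h'.1.1

/-! ### The case b = (N): middle cut, reflection and antidiagonal functional -/

/-- A cut in the middle that separates no block of size two, unless that block is the middle one. -/
theorem exists_middle_cut (ha : ∀ x ∈ a.blocks, x ∈ Finset.Icc 1 2) :
    ∃ r : ℕ, N ≤ 2 * r + 1 ∧ 2 * r ≤ N + 1 ∧ ∀ p q : Fin N, (p : ℕ) < r → r ≤ (q : ℕ) →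
      a.index p = a.index q → (p : ℕ) + q + 1 = N := by
  have ha' := fun {p q : Fin N} (h : p < q) (e : a.index p = a.index q) =>
    (sizeUpTo_of_blocks_le_two ha h e).1
  obtain ⟨k, hk | hk⟩ := Nat.even_or_odd' N
  · refine ⟨k, by omega, by omega, fun p q hp hq e => ?_⟩
    have := ha' (show p < q from hp.trans_le hq) e
    omega
  -- For N = 2k + 1, if a block of size two crosses the cut at k, it contains the middle vertex k,
  -- so no block crosses the cut at k + 1.
  · by_cases h : ∃ p q : Fin N, (p : ℕ) < k ∧ k ≤ (q : ℕ) ∧ a.index p = a.index q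
    · obtain ⟨p, q, hp, hq, e⟩ := h
      have h1 := ha' (show p < q from hp.trans_le hq) e
      refine ⟨k + 1, by omega, by omega, fun p' q' hp' hq' e' => ?_⟩
      have h2 := ha' (show p' < q' from hp'.trans_le hq') e'
      obtain rfl : q = p' := Fin.ext (by omega)
      have h3 := ha' (show p < q' from Fin.lt_def.2 (by omega)) (e.trans e')
      omega
    · exact ⟨k, by omega, by omega, fun p q hp hq e => absurd ⟨p, q, hp, hq, e⟩ h⟩

/-- The reflection of positions on one side of the cut `r` to positions across it. -/
def reflect (r : ℕ) (e : Fin N × Fin N) : Fin N × Fin N :=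
  if (e.2 : ℕ) < r then (e.2, e.1.rev) else (e.2.rev, e.1)

/-- The two branches land strictly on opposite sides of the antidiagonal. -/
theorem reflect_injOn {r : ℕ} {s : Set (Fin N × Fin N)} (hs : ∀ e ∈ s, e.1 < e.2) :
    Set.InjOn (reflect r) s := by
  rintro ⟨p, q⟩ h ⟨p', q'⟩ h' e
  have h1 := hs _ h
  have h2 := hs _ h'
  simp only [reflect, Fin.lt_def] at e h1 h2
  split_ifs at e <;> simp only [Prod.ext_iff, Fin.ext_iff, Fin.val_rev] at e ⊢ <;> omega

/-- The functional summing the strictly allowed entries on the antidiagonal. -/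
noncomputable def antidiagFunctional (a b : Composition N) :
    Module.Dual ℂ (Matrix (Fin N) (Fin N) ℂ) :=
  open Classical in
  ∑ i : Fin N, if StrictSupp a b i i.rev then entryLinearMap ℂ ℂ i i.rev else 0

open Classical in
theorem antidiagFunctional_apply (x : Matrix (Fin N) (Fin N) ℂ) :
    antidiagFunctional a b x = ∑ i : Fin N, if StrictSupp a b i i.rev then x i i.rev else 0 := by
  rw [antidiagFunctional, LinearMap.sum_apply]
  refine Finset.sum_congr rfl fun i _ => ?_
  split_ifs <;> simp

open Classical in
theorem antidiagFunctional_lie (x : Matrix (Fin N) (Fin N) ℂ) (p q : Fin N) :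
    antidiagFunctional a b (x * single p q 1 - single p q 1 * x) =
      (if StrictSupp a b q.rev q then x q.rev p else 0) -
        (if StrictSupp a b p p.rev then x q p.rev else 0) := by
  rw [map_sub, antidiagFunctional_apply, antidiagFunctional_apply]
  congr 1
  · rw [Finset.sum_eq_single q.rev]
    · simp
    · intro i _ hi
      rw [mul_single_apply_of_ne, ite_self]
      exact fun h => hi (by rw [← h, Fin.rev_rev])
    · simp
  · rw [Finset.sum_eq_single p]
    · simp
    · intro i _ hi
      rw [single_mul_apply_of_ne, ite_self]
      exact hi
    · simp

theorem strictSupp_single (hN : 0 < N) {p q : Fin N} :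
    StrictSupp a (Composition.single N hN) p q ↔ p < q ∧ a.index p ≠ a.index q := by
  have e := index_single hN p q
  simp only [StrictSupp, Supp]
  grind

/-- Reflection matches the pairs on one side of the cut with the straddling positions off the
antidiagonal. Those on it are the arcs of the single block. -/
theorem card_straddling {r : ℕ} (hr : N ≤ 2 * r + 1) (hr' : 2 * r ≤ N + 1) (hN : 0 < N) :
    (Finset.univ.filter fun e : Fin N × Fin N => (e.1 : ℕ) < r ∧ r ≤ (e.2 : ℕ)).card =
      (Finset.univ.filter fun e : Fin N × Fin N =>
        e.1 < e.2 ∧ ((e.2 : ℕ) < r ∨ r ≤ (e.1 : ℕ))).card +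
      (arcs (Composition.single N hN)).card := by
  have hinj := reflect_injOn (r := r)
    (s := ((Finset.univ.filter fun e : Fin N × Fin N =>
      e.1 < e.2 ∧ ((e.2 : ℕ) < r ∨ r ≤ (e.1 : ℕ)) : Finset (Fin N × Fin N)) : Set (Fin N × Fin N)))
    fun e he => (Finset.mem_filter.1 (Finset.mem_coe.1 he)).2.1
  rw [← Finset.card_image_of_injOn hinj, ← Finset.card_union_of_disjoint]
  · congr 1
    ext ⟨p, q⟩
    have hp := p.2
    have hq := q.2
    simp only [Finset.mem_filter, Finset.mem_univ, true_and, Finset.mem_union, Finset.mem_image,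
      mem_arcs_single, Prod.exists, Fin.lt_def]
    constructor
    · rintro ⟨h1, h2⟩
      rcases lt_trichotomy ((p : ℕ) + q + 1) N with h | h | h
      · refine Or.inl ⟨q, p.rev, ?_, ?_⟩
        · rw [Fin.val_rev]; omega
        · rw [reflect, if_neg (by simp only [Fin.val_rev]; omega), Fin.rev_rev]
      · exact Or.inr ⟨by omega, h⟩
      · refine Or.inl ⟨q.rev, p, ?_, ?_⟩
        · rw [Fin.val_rev]; omega
        · rw [reflect, if_pos h1, Fin.rev_rev]
    · rintro (⟨i, j, h, e⟩ | h)
      · have hi := i.2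
        have hj := j.2
        simp only [reflect] at e
        split_ifs at e <;> simp only [Prod.ext_iff, Fin.ext_iff, Fin.val_rev] at e <;> omega
      · omega
  · rw [Finset.disjoint_left]
    rintro ⟨p, q⟩ h h'
    obtain ⟨⟨i, j⟩, h, e⟩ := Finset.mem_image.1 h
    have hi := i.2
    have hj := j.2
    rw [mem_arcs_single] at h'
    simp only [Finset.mem_filter, Finset.mem_univ, true_and, Fin.lt_def] at h h'
    simp only [reflect] at e
    split_ifs at e <;> simp only [Prod.ext_iff, Fin.ext_iff, Fin.val_rev] at e <;> omega

theorem index_nilradical_single (hN : 0 < N) (ha : ∀ x ∈ a.blocks, x ∈ Finset.Icc 1 2)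
    (hb : b = Composition.single N hN) :
    LieAlgebra.index ℂ (LieAlgebra.nilradical ℂ (seaweed a b)) =
        (E₁ a b).card + (Cen a b).card ∧
      (LieAlgebra.index ℂ (LieAlgebra.nilradical ℂ (seaweedA a b)) : ℤ) =
        (E₁ a b).card + (Cen a b).card - 1 := by
  classical
  subst hb
  obtain ⟨r, hr, hr', hcut⟩ := exists_middle_cut ha
  have hadj := fun {p q : Fin N} (h : p < q) (e : a.index p = a.index q) =>
    (sizeUpTo_of_blocks_le_two ha h e).1
  have hfar : ∀ {p q : Fin N}, (p : ℕ) + 1 < q → StrictSupp a (Composition.single N hN) p q := by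
    intro p q h
    refine (strictSupp_single hN).2 ⟨Fin.lt_def.2 (by omega), fun e => ?_⟩
    have := hadj (Fin.lt_def.2 (by omega)) e
    omega
  -- The cut was chosen for this: a straddling position can fail to be strict only on the
  -- antidiagonal, so reflections of `Q` are strict.
  have hstraddle : ∀ {p q : Fin N}, (p : ℕ) < r → r ≤ (q : ℕ) → (p : ℕ) + q + 1 ≠ N →
      StrictSupp a (Composition.single N hN) p q := fun hp hq h =>
    (strictSupp_single hN).2 ⟨Fin.lt_def.2 (by omega), fun e => h (hcut _ _ hp hq e)⟩
  set S := Finset.univ.filter fun e : Fin N × Fin N =>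
    StrictSupp a (Composition.single N hN) e.1 e.2 with hSdef
  have hS : ∀ p q, (p, q) ∈ S ↔ StrictSupp a (Composition.single N hN) p q := by simp [hSdef]
  set Q := S.filter fun e => (e.2 : ℕ) < r ∨ r ≤ (e.1 : ℕ) with hQdef
  have hQ : ∀ {p q}, (p, q) ∈ Q ↔ StrictSupp a (Composition.single N hN) p q ∧
      ((q : ℕ) < r ∨ r ≤ (p : ℕ)) := by
    intro p q
    rw [hQdef, Finset.mem_filter, hS]
  have hlt : ∀ {p q}, StrictSupp a (Composition.single N hN) p q → (p : ℕ) < q :=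
    fun h => ((strictSupp_single hN).1 h).1
  have hQS : Q ⊆ S := Finset.filter_subset _ _
  have hinj : Set.InjOn (reflect r) (Q : Set (Fin N × Fin N)) :=
    reflect_injOn fun e he => hlt ((hQ (p := e.1) (q := e.2)).1 he).1
  have hreflect : ∀ {e}, e ∈ Q → ((reflect r e).1 : ℕ) < r ∧ r ≤ ((reflect r e).2 : ℕ) ∧
      ((reflect r e).1 : ℕ) + (reflect r e).2 + 1 ≠ N := by
    rintro ⟨p, q⟩ he
    obtain ⟨h1, h2⟩ := hQ.1 he
    have h3 := hlt h1
    have hq := q.2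
    simp only [reflect]
    split_ifs <;> simp only [Fin.val_rev] <;> omega
  have hdisj : Disjoint Q (Q.image (reflect r)) := by
    rw [Finset.disjoint_left]
    rintro ⟨p, q⟩ h h'
    obtain ⟨e, he, h'⟩ := Finset.mem_image.1 h'
    have h1 := hreflect he
    rw [h'] at h1
    have h2 := (hQ.1 h).2
    simp only at h1
    omega
  have hRS : Q ∪ Q.image (reflect r) ⊆ S := by
    refine Finset.union_subset hQS fun x hx => ?_
    obtain ⟨e, he, rfl⟩ := Finset.mem_image.1 hx
    have h1 := hreflect he
    exact (hS _ _).2 (hstraddle h1.1 h1.2.1 h1.2.2)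
  have hRQ : (Q ∪ Q.image (reflect r)).card = 2 * Q.card := by
    rw [Finset.card_union_of_disjoint hdisj, Finset.card_image_of_injOn hinj, two_mul]
  refine index_nilradical hN hS hQS hRS hRQ ?_ (antidiagFunctional a (Composition.single N hN))
    ?_ ?_
  -- If q lies before the cut, so does p, and the first position is in `Q`; otherwise the second is.
  · intro p q s h₁ h₂ h₃
    refine hQ.2 ⟨h₂, Or.inr ?_⟩
    by_contra h
    exact h₃ (hQ.2 ⟨h₁, Or.inl (by omega)⟩)
  · intro x hx hker
    have hlow : ∀ {p q : Fin N}, (q : ℕ) < p → x p q = 0 := fun {p q} h =>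
      hx.1 p q (fun e => by rw [e] at h; exact lt_irrefl _ h) fun h' => by
        have := hlt h'
        omega
    have key : ∀ {p q : Fin N}, StrictSupp a (Composition.single N hN) p q →
        (if StrictSupp a (Composition.single N hN) q.rev q then x q.rev p else 0) =
        (if StrictSupp a (Composition.single N hN) p p.rev then x q p.rev else 0) := by
      intro p q h
      have := hker p q h
      rw [antidiagFunctional_lie, sub_eq_zero] at this
      exact this
    intro p q hpq
    -- An entry in `Q` is isolated by testing against the reflected position, and a reflected entry
    -- by testing against its preimage. The other term of the bracket always falls below the
    -- diagonal and vanishes.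
    rcases Finset.mem_union.1 hpq with h | h
    · obtain ⟨h1, h2⟩ := hQ.1 h
      have h3 := hlt h1
      have hq := q.2
      rcases h2 with h2 | h2
      · have e := key (p := q) (q := p.rev)
          (hstraddle h2 (by rw [Fin.val_rev]; omega) (by rw [Fin.val_rev]; omega))
        rw [Fin.rev_rev, if_pos (hfar (by rw [Fin.val_rev]; omega)),
          hlow (p := p.rev) (q := q.rev) (by simp only [Fin.val_rev]; omega), ite_self] at e
        exact e
      · have e := key (p := q.rev) (q := p)
          (hstraddle (by rw [Fin.val_rev]; omega) h2 (by rw [Fin.val_rev]; omega))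
        rw [Fin.rev_rev, if_pos (hfar (p := q.rev) (q := q) (by rw [Fin.val_rev]; omega)),
          hlow (p := p.rev) (q := q.rev) (by simp only [Fin.val_rev]; omega), ite_self] at e
        exact e.symm
    · obtain ⟨⟨i, j⟩, he, h⟩ := Finset.mem_image.1 h
      obtain ⟨h1, h2⟩ := hQ.1 he
      have h3 := hlt h1
      have hj := j.2
      have e := key h1
      simp only [reflect] at h
      split_ifs at h with hjr
      · obtain ⟨rfl, rfl⟩ := Prod.ext_iff.1 h
        rw [if_pos (hfar (p := i) (q := i.rev) (by rw [Fin.val_rev]; omega)),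
          hlow (p := j.rev) (q := i) (by simp only [Fin.val_rev]; omega), ite_self] at e
        exact e.symm
      · obtain ⟨rfl, rfl⟩ := Prod.ext_iff.1 h
        rw [if_pos (hfar (p := j.rev) (q := j) (by rw [Fin.val_rev]; omega)),
          hlow (p := j) (q := i.rev) (by simp only [Fin.val_rev]; omega), ite_self] at e
        exact e
  -- Both sides of `card_straddling` are corrected for non-strict positions. Straddling ones are the
  -- arcs common to both compositions; those on one side of the cut are the remaining arcs of `a`.
  · have harcs : ∀ {p q}, (p, q) ∈ arcs a ↔ p < q ∧ a.index p = a.index q :=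
      mem_arcs_of_blocks_le_two ha
    have c1 := card_straddling hr hr' hN
    have c2 : S.card = (S.filter fun e => (e.1 : ℕ) < r ∧ r ≤ (e.2 : ℕ)).card + Q.card := by
      rw [← Finset.card_filter_add_card_filter_not (s := S)
        (p := fun e => (e.1 : ℕ) < r ∧ r ≤ (e.2 : ℕ))]
      congr 2
      refine Finset.filter_congr fun e _ => ?_
      omega
    have c3 : (Finset.univ.filter fun e : Fin N × Fin N => (e.1 : ℕ) < r ∧ r ≤ (e.2 : ℕ)).card =
        (S.filter fun e => (e.1 : ℕ) < r ∧ r ≤ (e.2 : ℕ)).card +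
          (arcs a ∩ arcs (Composition.single N hN)).card := by
      rw [← Finset.card_union_of_disjoint]
      · congr 1
        ext ⟨p, q⟩
        simp only [Finset.mem_filter, Finset.mem_univ, true_and, Finset.mem_union, hS,
          Finset.mem_inter, harcs, mem_arcs_single, strictSupp_single]
        have := hcut p q
        grind
      · rw [Finset.disjoint_left]
        rintro ⟨p, q⟩ h h'
        simp only [Finset.mem_filter, hS, Finset.mem_inter, harcs, strictSupp_single] at h h'
        exact h.1.2 h'.1.2
    have c4 : (Finset.univ.filter fun e : Fin N × Fin N =>
        e.1 < e.2 ∧ ((e.2 : ℕ) < r ∨ r ≤ (e.1 : ℕ))).card =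
        Q.card + (arcs a \ arcs (Composition.single N hN)).card := by
      rw [← Finset.card_union_of_disjoint]
      · congr 1
        ext ⟨p, q⟩
        simp only [Finset.mem_filter, Finset.mem_univ, true_and, Finset.mem_union, hQ,
          Finset.mem_sdiff, harcs, mem_arcs_single, strictSupp_single]
        have := hcut p q
        grind
      · rw [Finset.disjoint_left]
        rintro ⟨p, q⟩ h h'
        simp only [hQ, Finset.mem_sdiff, harcs, strictSupp_single] at h h'
        exact h.1.2 h'.1.2
    have c5 := Finset.card_sdiff_add_card_inter (arcs (Composition.single N hN)) (arcs a)
    rw [Finset.inter_comm] at c5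
    rw [card_E₁]
    omega

end Seaweed

theorem mainTheorem7 (N : ℕ) (hN : 0 < N) (a b : Composition N)
    (ha : ∀ x ∈ a.blocks, x ∈ Finset.Icc 1 2)
    (hb : (∀ x ∈ b.blocks, x ∈ Finset.Icc 1 2) ∨ b = Composition.single N hN) :
    LieAlgebra.index ℂ (LieAlgebra.nilradical ℂ (Seaweed.seaweed a b)) =
        (Seaweed.E₁ a b).card + (Seaweed.Cen a b).card ∧
      (LieAlgebra.index ℂ (LieAlgebra.nilradical ℂ (Seaweed.seaweedA a b)) : ℤ) =
        (Seaweed.E₁ a b).card + (Seaweed.Cen a b).card - 1 := by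
  rcases hb with hb | hb
  · exact Seaweed.index_nilradical_of_blocks_le_two hN ha hb
  · exact Seaweed.index_nilradical_single hN ha hb
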